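/- Let $K$ be a field of characteristic zero. For $n\ge 1$ write $z=(z_1,\dots,z_n)$ and $\xi=(\xi_1,\dots,\xi_n)$ for commuting variables. For a tuple $H=(H_1,\dots,H_n)\in K[z]^{n}$ let $o(H)$ be the smallest total degree of a monomial occurring in some $H_i$ with non-zero coefficient ($o(0)=+\infty$). The following two statements are equivalent. (a) The Jacobian conjecture over $K$ holds for all $n\ge 1$: for every $n\ge1$, every polynomial map $F=(F_1,\dots,F_n)\in K[z]^{n}$ with $\det(\partial F_i/\partial z_j)=1$ is an automorphism of affine $n$-space over $K$, i.e. there is $G\in K[z]^{n}$ with $F(G(z))=G(F(z))=z$. (b) For every $n\ge 1$ and every $H\in K[z]^{n}$ with $o(H)\ge 2$, the following holds for the polynomial $P(\xi,z)=\langle \xi,H(z)\rangle=\sum_{i=1}^n \xi_iH_i(z)\in K[\xi,z]$ and the differential operator $\Lambda=\sum_{i=1}^n\partial_{\xi_i}\partial_{z_i}$ of $K[\xi,z]$: if $\Lambda^m(P^m)=0$ for all $m\ge 1$, then there is $N$ such that $\Lambda^m(P^{m+1})=0$ for all $m\ge N$. -/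

import Mathlib

namespace JacVan

noncomputable section

/-- The Jacobian determinant `det (∂F_i / ∂z_j)` of a polynomial map `F = (F_1, …, F_n)`. -/
def jacobianDet {K : Type*} [CommRing K] {n : ℕ} (F : Fin n → MvPolynomial (Fin n) K) :
    MvPolynomial (Fin n) K :=
  (Matrix.of fun i j : Fin n => MvPolynomial.pderiv j (F i)).det

/-- The composition `F ∘ G` of polynomial maps, i.e. `(F_1(G), …, F_n(G))`. -/
def comp {K : Type*} [CommRing K] {n : ℕ} (F G : Fin n → MvPolynomial (Fin n) K) :
    Fin n → MvPolynomial (Fin n) K :=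
  fun i => MvPolynomial.bind₁ G (F i)

/-- A polynomial map is an automorphism of affine `n`-space if it has a two-sided inverse that is
again a polynomial map (as formal identities between tuples of polynomials). -/
def IsPolyAut {K : Type*} [CommRing K] {n : ℕ} (F : Fin n → MvPolynomial (Fin n) K) : Prop :=
  ∃ G : Fin n → MvPolynomial (Fin n) K,
    comp F G = (fun i => MvPolynomial.X i) ∧ comp G F = (fun i => MvPolynomial.X i)

/-- The Jacobian conjecture over `K` in dimension `n`. -/
def JacobianConjecture (K : Type*) [Field K] (n : ℕ) : Prop :=
  ∀ F : Fin n → MvPolynomial (Fin n) K, jacobianDet F = 1 → IsPolyAut F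

/-- The order `o(H)` of a tuple of polynomials: the minimum of the orders of its components, where
the order of a polynomial is the least degree of a monomial occurring in it (`⊤` for `0`). -/
def tupleOrder {K : Type*} [CommRing K] {n k : ℕ} (H : Fin k → MvPolynomial (Fin n) K) : ℕ∞ :=
  ⨅ i, (H i : MvPowerSeries (Fin n) K).order

/-- The assertion of the vanishing conjecture for a given operator `Λ` and a given polynomial `P`:
if `Λ^m (P^m) = 0` for all `m ≥ 1`, then `Λ^m (P^(m+1)) = 0` for all sufficiently large `m`. -/
def VanishingFor {K σ : Type*} [CommRing K] (Λ : Module.End K (MvPolynomial σ K))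
    (P : MvPolynomial σ K) : Prop :=
  (∀ m : ℕ, 1 ≤ m → (Λ ^ m) (P ^ m) = 0) →
    ∃ N : ℕ, ∀ m : ℕ, N ≤ m → (Λ ^ m) (P ^ (m + 1)) = 0

/-- The variable `ξ_i` of the polynomial ring in `(ξ, z)`; the index type of the variables is
`Fin n ⊕ Fin n`, the left summand for `ξ` and the right one for `z`. -/
abbrev xi (K : Type*) [CommRing K] {n : ℕ} (i : Fin n) : MvPolynomial (Fin n ⊕ Fin n) K :=
  MvPolynomial.X (Sum.inl i)

/-- The operator `Λ = ∑ i, ∂_{ξ_i} ∂_{z_i}` on polynomials in `(ξ, z)`. -/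
def Lam (K : Type*) [CommRing K] (n : ℕ) : Module.End K (MvPolynomial (Fin n ⊕ Fin n) K) :=
  ∑ i : Fin n,
    (MvPolynomial.pderiv (R := K) (Sum.inl i : Fin n ⊕ Fin n)).toLinearMap ∘ₗ
      (MvPolynomial.pderiv (R := K) (Sum.inr i : Fin n ⊕ Fin n)).toLinearMap

/-- The polynomial `⟨ξ, H(z)⟩ = ∑ i, ξ_i H_i(z)` in `(ξ, z)`. -/
def xiPairing {K : Type*} [CommRing K] {n : ℕ} (H : Fin n → MvPolynomial (Fin n) K) :
    MvPolynomial (Fin n ⊕ Fin n) K :=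
  ∑ i : Fin n, xi K i * MvPolynomial.rename Sum.inr (H i)

end

end JacVan

/-!
The bridge between the two statements is the Abhyankar–Gurjar inversion formula for the formal
inverse `G` of `z - t H` over `K[z]⟦t⟧`. For `u ∈ K[z]` put
`E_m(u) = ∑_{|β| = m} (1 / β!) ∂^β (u H^β)` (`inversionCoeff`) and `E(u) = ∑ m, E_m(u) t^m`.
Since `P` is linear in `ξ`, the polynomial `Λ^m (P^m)` is a nonzero multiple of `E_m(1)`, and the
coefficients of the `ξ_i` in `Λ^m (P^(m+1))` are nonzero multiples of the `E_m(H_i)`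
(`vanishingFor_iff`).

The rule `E(z_k u) = z_k E(u) + t E(H_k u)` determines a linear map from its value at `1`
(`IsIntertwining.ext`). Consequently `E(u) = E(1) φ(u)` with a homomorphism `φ`, namely
`φ(u) = u(G)`. The factor `E(1)` is the inverse of `det (1 - t (JH)(G))`
(`inversionSeries_one_mul_det`): the derivation `∂_t - ∑ j, H_j(G) ∂_j` kills the image of `φ`, and
by the continuity equation for `E` together with Jacobi's formula it kills the product of the two
factors. Hence the hypothesis of the vanishing conjecture says that
`det (1 - t JH) = 1`, i.e. that `JH` is nilpotent (`inversionCoeff_one_eq_zero_iff`), and its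
conclusion says that `G` is polynomial in `t`.

From (a) to (b), the Jacobian conjecture for `(t, z - t H)` in dimension `n + 1` makes `G` polynomial
(`vanishingFor_of_jacobianConjecture`). From (b) to (a), an affine change of coordinates brings a map
with Jacobian determinant `1` to the form `z - ∑ k, B_k` with `B_k` homogeneous of degree `k + 2`,
`0 ≤ k ≤ d`. Homogeneity turns the determinant condition into
`det (1 - ∑ k, s^(k+1) JB_k) = 1`. This is exactly nilpotency of the Jacobian matrix of the larger map
`y ↦ (B_0(y_0) + y_1, …, B_{d-1}(y_0) + y_d, B_d(y_0))` (`hasNilpotentJacobian_unfolding`), and an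
inverse of `y` minus this map yields one of the original map (`exists_rightInverse_of_unfolding`).
Multiplication by one further variable, which is set to `1` in the end, raises the order to at least
`2`, so that (b) applies (`exists_rightInverse_fin`).
-/

namespace JacVan

noncomputable section

open MvPolynomial

/-! ### The operators of the inversion formula -/

lemma natCast_succ_mul_cancel {K σ : Type*} [Field K] [CharZero K] {m : ℕ} {a b : MvPolynomial σ K}
    (h : ((m : MvPolynomial σ K) + 1) * a = ((m : MvPolynomial σ K) + 1) * b) : a = b :=
  mul_left_cancel₀ (by exact_mod_cast m.succ_ne_zero) h

section InversionCoeff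

variable {K σ : Type*} [Field K] [Fintype σ]

/-- The operator `u ↦ ∑_{|β| = m} (1 / β!) ∂^β (u H^β)`, which carries the degree `m` part of the
Abhyankar–Gurjar inversion formula for `z - t H`. It is encoded by the recursion
`m E_m(u) = ∑ i, ∂_i (E_{m-1} (H_i u))`, which avoids multi-indices. -/
def inversionCoeff (H : σ → MvPolynomial σ K) : ℕ → MvPolynomial σ K →ₗ[K] MvPolynomial σ K
  | 0 => LinearMap.id
  | m + 1 => ((m + 1 : ℕ) : K)⁻¹ • ∑ i, (pderiv i).toLinearMap ∘ₗ inversionCoeff H m ∘ₗ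
      LinearMap.mulLeft K (H i)

variable (H : σ → MvPolynomial σ K)

@[simp]
lemma inversionCoeff_zero (u : MvPolynomial σ K) : inversionCoeff H 0 u = u := rfl

variable [CharZero K]

lemma inversionCoeff_succ (m : ℕ) (u : MvPolynomial σ K) :
    ((m : MvPolynomial σ K) + 1) * inversionCoeff H (m + 1) u =
      ∑ i, pderiv i (inversionCoeff H m (H i * u)) := by
  have h : ((m : MvPolynomial σ K) + 1) = C ((m + 1 : ℕ) : K) := by simp
  have h' : ((m + 1 : ℕ) : K) ≠ 0 := Nat.cast_ne_zero.2 m.succ_ne_zero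
  rw [h, ← smul_eq_C_mul, inversionCoeff, LinearMap.smul_apply, smul_smul, mul_inv_cancel₀ h',
    one_smul]
  simp

/-- The commutation rule `[E_{m+1}, z_k] = E_m H_k`, from which all multiplicative properties of the
operators follow. -/
lemma inversionCoeff_succ_X_mul [DecidableEq σ] (m : ℕ) (k : σ) (u : MvPolynomial σ K) :
    inversionCoeff H (m + 1) (X k * u) =
      X k * inversionCoeff H (m + 1) u + inversionCoeff H m (H k * u) := by
  induction m generalizing u with
  | zero =>
    apply natCast_succ_mul_cancel
    rw [mul_add, mul_left_comm, inversionCoeff_succ, inversionCoeff_succ]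
    simp only [inversionCoeff_zero, mul_left_comm _ (X k), pderiv_mul (f := X k), pderiv_X,
      Finset.sum_add_distrib, Finset.mul_sum, Pi.single_apply, ite_mul, one_mul, zero_mul,
      Finset.sum_ite_eq, Finset.mem_univ, if_true]
    push_cast
    ring
  | succ m ih =>
    apply natCast_succ_mul_cancel
    rw [mul_add, mul_left_comm, inversionCoeff_succ, inversionCoeff_succ]
    simp only [mul_left_comm _ (X k), ih, pderiv_mul (f := X k), pderiv_X, map_add,
      Finset.sum_add_distrib, Finset.mul_sum, Pi.single_apply, ite_mul, one_mul, zero_mul,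
      Finset.sum_ite_eq, Finset.mem_univ, if_true]
    simp only [mul_left_comm (H k) (H _), ← inversionCoeff_succ]
    push_cast
    ring

end InversionCoeff

/-! ### The Laplacian on powers of the pairing -/

lemma pderiv_comm {K σ : Type*} [CommRing K] (i j : σ) (A : MvPolynomial σ K) :
    pderiv i (pderiv j A) = pderiv j (pderiv i A) := by
  classical
  have h : ⁅pderiv (R := K) i, pderiv (R := K) j⁆ = 0 := by
    apply MvPolynomial.derivation_ext
    intro k
    simp [Derivation.commutator_apply, pderiv_X, Pi.single_apply, apply_ite]
  have := congrArg (fun D => D A) h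
  simpa [Derivation.commutator_apply, sub_eq_zero] using this

section Laplacian

variable {K : Type*} [Field K] {n : ℕ}

lemma Lam_apply (A : MvPolynomial (Fin n ⊕ Fin n) K) :
    Lam K n A = ∑ i, pderiv (Sum.inl i) (pderiv (Sum.inr i) A) := by
  simp [Lam]

lemma Lam_xi_mul (i : Fin n) (A : MvPolynomial (Fin n ⊕ Fin n) K) :
    Lam K n (xi K i * A) = xi K i * Lam K n A + pderiv (Sum.inr i) A := by
  simp only [Lam_apply, xi, pderiv_mul, pderiv_X, Pi.single_apply, Finset.sum_add_distrib,
    Finset.mul_sum, reduceCtorEq, if_false, zero_mul, zero_add, Sum.inl.injEq, ite_mul, one_mul,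
    Finset.sum_ite_eq, Finset.mem_univ, if_true]
  ring

lemma Lam_pow_pderiv (m : ℕ) (i : Fin n ⊕ Fin n) (A : MvPolynomial (Fin n ⊕ Fin n) K) :
    (Lam K n ^ m) (pderiv i A) = pderiv i ((Lam K n ^ m) A) := by
  induction m generalizing A with
  | zero => simp
  | succ m ih =>
    have h : Lam K n (pderiv i A) = pderiv i (Lam K n A) := by
      simp only [Lam_apply, map_sum, pderiv_comm _ i]
    simp only [pow_succ, Module.End.mul_apply, h, ih]

lemma Lam_pow_succ_xi_mul (m : ℕ) (i : Fin n) (A : MvPolynomial (Fin n ⊕ Fin n) K) :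
    (Lam K n ^ (m + 1)) (xi K i * A) = xi K i * (Lam K n ^ (m + 1)) A +
      ((m : MvPolynomial (Fin n ⊕ Fin n) K) + 1) * pderiv (Sum.inr i) ((Lam K n ^ m) A) := by
  induction m generalizing A with
  | zero => simp [Lam_xi_mul]
  | succ m ih =>
    rw [pow_succ, Module.End.mul_apply, Lam_xi_mul, map_add, ih, Lam_pow_pderiv]
    simp only [pow_succ, Module.End.mul_apply]
    push_cast
    ring

variable (H : Fin n → MvPolynomial (Fin n) K)

lemma Lam_pow_succ_xiPairing_mul (m k : ℕ) (u : MvPolynomial (Fin n) K) :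
    (Lam K n ^ (m + 1)) (xiPairing H ^ (k + 1) * rename Sum.inr u) =
      ∑ i, (xi K i * (Lam K n ^ (m + 1)) (xiPairing H ^ k * rename Sum.inr (H i * u)) +
        ((m : MvPolynomial (Fin n ⊕ Fin n) K) + 1) *
          pderiv (Sum.inr i) ((Lam K n ^ m) (xiPairing H ^ k * rename Sum.inr (H i * u)))) := by
  have h : xiPairing H ^ (k + 1) * rename Sum.inr u =
      ∑ i, xi K i * (xiPairing H ^ k * rename Sum.inr (H i * u)) := by
    rw [pow_succ, mul_right_comm, mul_comm, xiPairing, Finset.sum_mul]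
    refine Finset.sum_congr rfl fun i _ => ?_
    rw [map_mul]
    ring
  rw [h, map_sum]
  exact Finset.sum_congr rfl fun i _ => Lam_pow_succ_xi_mul m i _

lemma Lam_pow_eq_zero_of_lt {m k : ℕ} (hk : k < m) (u : MvPolynomial (Fin n) K) :
    (Lam K n ^ m) (xiPairing H ^ k * rename Sum.inr u) = 0 := by
  induction k generalizing m u with
  | zero =>
    obtain ⟨m, rfl⟩ := Nat.exists_eq_succ_of_ne_zero hk.ne'
    have h : Lam K n (rename Sum.inr u) = 0 := by
      rw [Lam_apply]
      refine Finset.sum_eq_zero fun i _ => ?_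
      rw [pderiv_rename Sum.inr_injective]
      refine pderiv_eq_zero_of_notMem_vars fun hi => ?_
      have := vars_rename Sum.inr (pderiv i u) hi
      simp at this
    rw [pow_succ, Module.End.mul_apply, pow_zero, one_mul, h, map_zero]
  | succ k ih =>
    obtain ⟨m, rfl⟩ := Nat.exists_eq_succ_of_ne_zero (Nat.ne_zero_of_lt hk)
    rw [Nat.succ_eq_add_one, Lam_pow_succ_xiPairing_mul]
    refine Finset.sum_eq_zero fun i _ => ?_
    rw [ih (by omega), ih (by omega)]
    simp

variable [CharZero K]

/-- In the case `u = 1`, the hypothesis of the vanishing conjecture: up to a nonzero constant,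
`Λ^m (P^m)` is `E_m(1)`. -/
lemma Lam_pow_xiPairing_pow (m : ℕ) (u : MvPolynomial (Fin n) K) :
    (Lam K n ^ m) (xiPairing H ^ m * rename Sum.inr u) =
      (m.factorial : MvPolynomial (Fin n ⊕ Fin n) K) ^ 2 *
        rename Sum.inr (inversionCoeff H m u) := by
  induction m generalizing u with
  | zero => simp
  | succ m ih =>
    have key := congrArg (rename (Sum.inr : Fin n → Fin n ⊕ Fin n)) (inversionCoeff_succ H m u)
    simp only [map_mul, map_sum, map_add, map_natCast, map_one,
      ← pderiv_rename (f := (Sum.inr : Fin n → Fin n ⊕ Fin n)) Sum.inr_injective] at key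
    rw [Lam_pow_succ_xiPairing_mul]
    simp only [Lam_pow_eq_zero_of_lt H (Nat.lt_succ_self m), mul_zero, zero_add, ih]
    have hc (i : Fin n) (A : MvPolynomial (Fin n ⊕ Fin n) K) :
        pderiv (Sum.inr i) ((m.factorial : MvPolynomial (Fin n ⊕ Fin n) K) ^ 2 * A) =
          (m.factorial : MvPolynomial (Fin n ⊕ Fin n) K) ^ 2 * pderiv (Sum.inr i) A := by
      simp
    simp only [hc, ← Finset.mul_sum, ← key, Nat.factorial_succ]
    push_cast
    ring

/-- In the case `u = 1`, the conclusion of the vanishing conjecture: up to a nonzero constant, the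
coefficient of `ξ_i` in `Λ^m (P^(m+1))` is `E_m(H_i)`. -/
lemma Lam_pow_xiPairing_pow_succ (m : ℕ) (u : MvPolynomial (Fin n) K) :
    (Lam K n ^ m) (xiPairing H ^ (m + 1) * rename Sum.inr u) =
      ((m.factorial : MvPolynomial (Fin n ⊕ Fin n) K) * ((m + 1).factorial : MvPolynomial _ K)) *
        ∑ i, xi K i * rename Sum.inr (inversionCoeff H m (H i * u)) := by
  induction m generalizing u with
  | zero => simp [xiPairing, Finset.sum_mul, mul_assoc]
  | succ m ih =>
    have key (v : MvPolynomial (Fin n) K) :=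
      congrArg (rename (Sum.inr : Fin n → Fin n ⊕ Fin n)) (inversionCoeff_succ H m v)
    simp only [map_mul (rename _), map_sum, map_add, map_natCast, map_one,
      ← pderiv_rename (f := (Sum.inr : Fin n → Fin n ⊕ Fin n)) Sum.inr_injective] at key
    have hc (i : Fin n) (A : MvPolynomial (Fin n ⊕ Fin n) K) :
        pderiv (Sum.inr i) (((m.factorial : MvPolynomial (Fin n ⊕ Fin n) K) *
          ((m + 1).factorial : MvPolynomial _ K)) * A) =
          ((m.factorial : MvPolynomial (Fin n ⊕ Fin n) K) *
            ((m + 1).factorial : MvPolynomial _ K)) * pderiv (Sum.inr i) A := by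
      simp
    have hx (i j : Fin n) (A : MvPolynomial (Fin n ⊕ Fin n) K) :
        pderiv (Sum.inr i) (xi K j * A) = xi K j * pderiv (Sum.inr i) A := by
      simp [xi, pderiv_X]
    rw [Lam_pow_succ_xiPairing_mul]
    simp only [Lam_pow_xiPairing_pow, ih, hc, map_sum, hx, Finset.sum_add_distrib,
      mul_left_comm (H _) (H _) u]
    simp only [← Finset.mul_sum]
    rw [Finset.sum_comm]
    simp only [← Finset.mul_sum, ← key]
    simp only [Finset.mul_sum, ← Finset.sum_add_distrib]
    refine Finset.sum_congr rfl fun i _ => ?_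
    simp only [Nat.factorial_succ]
    push_cast
    ring

/-- The assertion of the vanishing conjecture in terms of the inversion formula. -/
lemma vanishingFor_iff :
    VanishingFor (Lam K n) (xiPairing H) ↔ ((∀ m, 1 ≤ m → inversionCoeff H m 1 = 0) →
      ∃ N, ∀ m, N ≤ m → ∀ i, inversionCoeff H m (H i) = 0) := by
  have hinj := rename_injective (R := K) (Sum.inr : Fin n → Fin n ⊕ Fin n) Sum.inr_injective
  have hf (m : ℕ) : (m.factorial : MvPolynomial (Fin n ⊕ Fin n) K) ≠ 0 :=
    Nat.cast_ne_zero.2 m.factorial_ne_zero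
  have h1 (m : ℕ) : (Lam K n ^ m) (xiPairing H ^ m) = 0 ↔ inversionCoeff H m 1 = 0 := by
    have := Lam_pow_xiPairing_pow H m 1
    rw [map_one, mul_one] at this
    rw [this, mul_eq_zero, or_iff_right (pow_ne_zero 2 (hf m)), map_eq_zero_iff _ hinj]
  have h2 (m : ℕ) : (Lam K n ^ m) (xiPairing H ^ (m + 1)) = 0 ↔
      ∀ i, inversionCoeff H m (H i) = 0 := by
    have := Lam_pow_xiPairing_pow_succ H m 1
    simp only [map_one, mul_one] at this
    rw [this, mul_eq_zero, or_iff_right (mul_ne_zero (hf m) (hf (m + 1)))]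
    refine ⟨fun h i => ?_, fun h => by simp [h]⟩
    have h' := congrArg (pderiv (Sum.inl i)) h
    have hz (A : MvPolynomial (Fin n) K) :
        pderiv (Sum.inl i : Fin n ⊕ Fin n) (rename Sum.inr A) = 0 := by
      refine pderiv_eq_zero_of_notMem_vars fun hi => ?_
      have := vars_rename Sum.inr A hi
      simp at this
    simpa only [map_sum, pderiv_mul, hz, xi, pderiv_X, Pi.single_apply, mul_zero, add_zero,
      Sum.inl.injEq, ite_mul, one_mul, zero_mul, Finset.sum_ite_eq', Finset.mem_univ, if_true,
      map_zero, map_eq_zero_iff _ hinj] using h'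
  simp only [VanishingFor, h1, h2]

end Laplacian

/-! ### The generating series of the operators -/

lemma derivation_map_prod {K A ι : Type*} [CommRing K] [CommRing A] [Algebra K A]
    [DecidableEq ι] (D : Derivation K A A) (s : Finset ι) (f : ι → A) :
    D (∏ i ∈ s, f i) = ∑ i ∈ s, (∏ j ∈ s.erase i, f j) * D (f i) := by
  induction s using Finset.induction_on with
  | empty => simp
  | insert a s ha ih =>
    rw [Finset.prod_insert ha, D.leibniz, Finset.sum_insert ha, Finset.erase_insert ha, ih,
      smul_eq_mul, smul_eq_mul, Finset.mul_sum, add_comm]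
    congr 1
    refine Finset.sum_congr rfl fun i hi => ?_
    have hia : a ≠ i := fun h => ha (h ▸ hi)
    rw [Finset.erase_insert_of_ne hia, Finset.prod_insert (by simp [ha]), mul_assoc]

/-- Jacobi's formula for the derivative of a determinant. -/
lemma derivation_map_det {K A ι : Type*} [CommRing K] [CommRing A] [Algebra K A]
    [Fintype ι] [DecidableEq ι] (D : Derivation K A A) (M : Matrix ι ι A) :
    D M.det = (M.adjugate * M.map D).trace := by
  have h (i : ι) : (M.adjugate * M.map D) i i = (M.updateCol i fun j => D (M j i)).det := by
    rw [← Matrix.cramer_apply, Matrix.cramer_eq_adjugate_mulVec]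
    rfl
  simp only [Matrix.trace, Matrix.diag_apply, h, Matrix.det_apply, map_sum]
  rw [Finset.sum_comm]
  refine Finset.sum_congr rfl fun s _ => ?_
  rw [Units.smul_def, map_zsmul, derivation_map_prod, Finset.smul_sum]
  refine Finset.sum_congr rfl fun i hi => ?_
  rw [← Units.smul_def, ← Finset.mul_prod_erase _ _ hi, mul_comm]
  congr 2
  · simp
  · exact Finset.prod_congr rfl fun j hj => by rw [Matrix.updateCol_ne (Finset.ne_of_mem_erase hj)]

section Series

variable {K σ : Type*} [Field K]

/-- A linear map `T : K[z] → K[z]⟦t⟧` intertwines multiplication by `z_k - t H_k` with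
multiplication by `z_k`. -/
def IsIntertwining (H : σ → MvPolynomial σ K)
    (T : MvPolynomial σ K →ₗ[K] PowerSeries (MvPolynomial σ K)) : Prop :=
  ∀ k u, T (X k * u) = PowerSeries.C (X k) * T u + PowerSeries.X * T (H k * u)

/-- Intertwining maps are determined by their value at `1`, which gives both the multiplicativity of
the generating series and the uniqueness of the formal inverse. -/
lemma IsIntertwining.ext {H : σ → MvPolynomial σ K}
    {T₁ T₂ : MvPolynomial σ K →ₗ[K] PowerSeries (MvPolynomial σ K)}
    (h₁ : IsIntertwining H T₁) (h₂ : IsIntertwining H T₂) (h : T₁ 1 = T₂ 1) : T₁ = T₂ := by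
  have hC (a : K) : T₁ (C a) = T₂ (C a) := by
    rw [← mul_one (C a), ← smul_eq_C_mul, map_smul, map_smul, h]
  have key (m : ℕ) : ∀ u, PowerSeries.coeff m (T₁ u) = PowerSeries.coeff m (T₂ u) := by
    induction m with
    | zero =>
      intro u
      induction u using MvPolynomial.induction_on with
      | C a => rw [hC]
      | add p q hp hq => simp only [map_add, hp, hq]
      | mul_X p i hp =>
        rw [mul_comm, h₁, h₂]
        simpa using hp
    | succ m ih =>
      intro u
      induction u using MvPolynomial.induction_on with
      | C a => rw [hC]
      | add p q hp hq => simp only [map_add, hp, hq]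
      | mul_X p i hp =>
        rw [mul_comm, h₁, h₂]
        simp only [map_add, PowerSeries.coeff_C_mul, PowerSeries.coeff_succ_X_mul, hp, ih]
  exact LinearMap.ext fun u => PowerSeries.ext fun m => key m u

variable [Fintype σ] (H : σ → MvPolynomial σ K)

/-- The generating series `E(u) = ∑ m, E_m(u) t^m`. -/
def inversionSeries : MvPolynomial σ K →ₗ[K] PowerSeries (MvPolynomial σ K) where
  toFun u := PowerSeries.mk fun m => inversionCoeff H m u
  map_add' u v := by ext1 m; simp
  map_smul' a u := by ext1 m; simp

@[simp]
lemma coeff_inversionSeries (m : ℕ) (u : MvPolynomial σ K) :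
    PowerSeries.coeff m (inversionSeries H u) = inversionCoeff H m u := by
  simp [inversionSeries]

@[simp]
lemma constantCoeff_inversionSeries (u : MvPolynomial σ K) :
    PowerSeries.constantCoeff (inversionSeries H u) = u := by
  rw [← PowerSeries.coeff_zero_eq_constantCoeff_apply, coeff_inversionSeries, inversionCoeff_zero]

lemma isUnit_inversionSeries_one : IsUnit (inversionSeries H 1) := by
  simp [PowerSeries.isUnit_iff_constantCoeff]

variable [DecidableEq σ] [CharZero K]

lemma isIntertwining_inversionSeries : IsIntertwining H (inversionSeries H) := by
  intro k u
  ext1 m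
  cases m with
  | zero => simp
  | succ m => simp [inversionCoeff_succ_X_mul]

lemma inversionSeries_one_mul (u v : MvPolynomial σ K) :
    inversionSeries H 1 * inversionSeries H (u * v) =
      inversionSeries H u * inversionSeries H v := by
  have hE := isIntertwining_inversionSeries H
  let T₁ := LinearMap.mulLeft K (inversionSeries H 1) ∘ₗ inversionSeries H ∘ₗ LinearMap.mulRight K v
  let T₂ := LinearMap.mulRight K (inversionSeries H v) ∘ₗ inversionSeries H
  have h : T₁ = T₂ := by
    refine IsIntertwining.ext (H := H) (fun k u => ?_) (fun k u => ?_) ?_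
    · simp only [T₁, LinearMap.comp_apply, LinearMap.mulLeft_apply, LinearMap.mulRight_apply,
        mul_assoc, hE k]
      ring
    · simp only [T₂, LinearMap.comp_apply, LinearMap.mulRight_apply, hE k]
      ring
    · simp [T₁, T₂]
  simpa [T₁, T₂] using congrArg (fun T => T u) h

/-- The homomorphism `φ : u ↦ u(G)` of substitution of the formal inverse `G` of `z - t H`,
obtained as `E(u) / E(1)`. -/
def inversionHom : MvPolynomial σ K →ₐ[K] PowerSeries (MvPolynomial σ K) :=
  AlgHom.ofLinearMap
    (LinearMap.mulLeft K (↑(isUnit_inversionSeries_one H).unit⁻¹ : PowerSeries (MvPolynomial σ K)) ∘ₗ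
      inversionSeries H)
    (by simp)
    (fun u v => by
      have hJ := (isUnit_inversionSeries_one H).val_inv_mul
      simp only [LinearMap.comp_apply, LinearMap.mulLeft_apply]
      set a : PowerSeries (MvPolynomial σ K) := ↑(isUnit_inversionSeries_one H).unit⁻¹
      linear_combination a ^ 2 * inversionSeries_one_mul H u v -
        a * inversionSeries H (u * v) * hJ)

lemma inversionSeries_eq (u : MvPolynomial σ K) :
    inversionSeries H u = inversionSeries H 1 * inversionHom H u := by
  have hJ := (isUnit_inversionSeries_one H).mul_val_inv
  simp only [inversionHom, AlgHom.ofLinearMap_apply, LinearMap.comp_apply, LinearMap.mulLeft_apply,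
    ← mul_assoc, hJ, one_mul]

lemma inversionHom_X (k : σ) :
    inversionHom H (X k) = PowerSeries.C (X k) + PowerSeries.X * inversionHom H (H k) := by
  have h := isIntertwining_inversionSeries H k 1
  rw [mul_one, mul_one, inversionSeries_eq, inversionSeries_eq H (H k)] at h
  refine (isUnit_inversionSeries_one H).mul_left_cancel ?_
  rw [h]
  ring

lemma constantCoeff_inversionHom (u : MvPolynomial σ K) :
    PowerSeries.constantCoeff (inversionHom H u) = u := by
  have h := congrArg PowerSeries.constantCoeff (inversionSeries_eq H u)
  simpa using h.symm

/-- Uniqueness of the formal inverse of `z - t H`. -/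
lemma eq_inversionHom {ψ : MvPolynomial σ K →ₐ[K] PowerSeries (MvPolynomial σ K)}
    (h : ∀ k, ψ (X k) = PowerSeries.C (X k) + PowerSeries.X * ψ (H k)) : ψ = inversionHom H := by
  have : ψ.toLinearMap = (inversionHom H).toLinearMap := by
    refine IsIntertwining.ext (H := H) (fun k u => ?_) (fun k u => ?_) (by simp)
    · simp only [AlgHom.toLinearMap_apply, map_mul, h]
      ring
    · simp only [AlgHom.toLinearMap_apply, map_mul, inversionHom_X]
      ring
  exact AlgHom.toLinearMap_injective this

end Series

/-! ### The transport equation and the Jacobian determinant -/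

section Transport

variable {K σ : Type*} [Field K]

/-- The derivation `∂_j` of `K[z]⟦t⟧` acting on coefficients. -/
def coeffDeriv (j : σ) :
    Derivation K (PowerSeries (MvPolynomial σ K)) (PowerSeries (MvPolynomial σ K)) :=
  Derivation.mk'
    { toFun := fun f => PowerSeries.mk fun m => pderiv j (PowerSeries.coeff m f)
      map_add' := fun f g => by ext1 m; simp
      map_smul' := fun a f => by ext1 m; simp }
    (fun f g => by
      ext1 m
      simp only [LinearMap.coe_mk, AddHom.coe_mk, PowerSeries.coeff_mk, smul_eq_mul, map_add,
        PowerSeries.coeff_mul, map_sum, pderiv_mul, Finset.sum_add_distrib]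
      rw [add_comm]
      congr 1
      rw [← Finset.Nat.sum_antidiagonal_swap]
      exact Finset.sum_congr rfl fun p _ => mul_comm _ _)

@[simp]
lemma coeff_coeffDeriv (j : σ) (f : PowerSeries (MvPolynomial σ K)) (m : ℕ) :
    PowerSeries.coeff m (coeffDeriv j f) = pderiv j (PowerSeries.coeff m f) := by
  simp [coeffDeriv]

lemma coeffDeriv_C (j : σ) (u : MvPolynomial σ K) :
    coeffDeriv j (PowerSeries.C u) = PowerSeries.C (pderiv j u) := by
  ext1 m
  simp only [coeff_coeffDeriv, PowerSeries.coeff_C]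
  split_ifs <;> simp

lemma coeffDeriv_X (j : σ) :
    coeffDeriv j (PowerSeries.X : PowerSeries (MvPolynomial σ K)) = 0 := by
  ext1 m
  simp [PowerSeries.coeff_X, apply_ite]

variable [Fintype σ]

/-- The continuity equation `∂_t E(u) = ∑ j, ∂_j E(H_j u)`. -/
lemma derivative_inversionSeries [CharZero K] (H : σ → MvPolynomial σ K) (u : MvPolynomial σ K) :
    PowerSeries.derivative (MvPolynomial σ K) (inversionSeries H u) =
      ∑ j, coeffDeriv j (inversionSeries H (H j * u)) := by
  ext1 m
  simp only [PowerSeries.coeff_derivative, map_sum, coeff_coeffDeriv, coeff_inversionSeries]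
  rw [mul_comm, inversionCoeff_succ]

variable [DecidableEq σ]

/-- The chain rule for substitution homomorphisms. -/
lemma coeffDeriv_algHom (j : σ) (ψ : MvPolynomial σ K →ₐ[K] PowerSeries (MvPolynomial σ K))
    (u : MvPolynomial σ K) :
    coeffDeriv j (ψ u) = ∑ k, ψ (pderiv k u) * coeffDeriv j (ψ (X k)) := by
  induction u using MvPolynomial.induction_on with
  | C a =>
    have h : ψ (C a) = algebraMap K _ a := ψ.commutes a
    simp [h]
  | add p q hp hq => simp only [map_add, hp, hq, add_mul, Finset.sum_add_distrib]
  | mul_X p i hp =>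
    simp only [map_mul, Derivation.leibniz, smul_eq_mul, hp, map_add, pderiv_X, Pi.single_apply,
      apply_ite, map_zero, mul_one, mul_zero, add_mul, ite_mul, zero_mul,
      Finset.sum_add_distrib, Finset.sum_ite_eq, Finset.mem_univ, if_true,
      Finset.mul_sum, mul_assoc]

variable [CharZero K] (H : σ → MvPolynomial σ K)

/-- The derivation `∂_t - ∑ j, H_j(G) ∂_j` of `K[z]⟦t⟧`, whose constants include all `u(G)`. -/
def transport :
    Derivation K (PowerSeries (MvPolynomial σ K)) (PowerSeries (MvPolynomial σ K)) :=
  (PowerSeries.derivative (MvPolynomial σ K)).restrictScalars K -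
    ∑ j, inversionHom H (H j) • coeffDeriv j

lemma transport_apply (f : PowerSeries (MvPolynomial σ K)) :
    transport H f = PowerSeries.derivative (MvPolynomial σ K) f -
      ∑ j, inversionHom H (H j) * coeffDeriv j f := by
  have h : (∑ j, inversionHom H (H j) • coeffDeriv j :
      Derivation K (PowerSeries (MvPolynomial σ K)) _) f =
      ∑ j, inversionHom H (H j) * coeffDeriv j f := by
    rw [← Derivation.coeFnAddMonoidHom_apply, map_sum, Finset.sum_apply]
    rfl
  rw [transport, Derivation.sub_apply, h]
  rfl

lemma eq_zero_of_transport_eq_zero {f : PowerSeries (MvPolynomial σ K)} (hf : transport H f = 0)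
    (h0 : PowerSeries.constantCoeff f = 0) : f = 0 := by
  have key (m : ℕ) : PowerSeries.coeff m f = 0 := by
    induction m using Nat.strong_induction_on with
    | _ m ih =>
      cases m with
      | zero => simpa using h0
      | succ m =>
        rw [transport_apply, sub_eq_zero] at hf
        have h := congrArg (PowerSeries.coeff m) hf
        rw [PowerSeries.coeff_derivative, map_sum] at h
        rw [Finset.sum_eq_zero] at h
        · exact (mul_eq_zero.1 h).resolve_right (by exact_mod_cast m.succ_ne_zero)
        · intro j _
          rw [PowerSeries.coeff_mul]
          refine Finset.sum_eq_zero fun p hp => ?_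
          have : p.2 ≤ m := by
            have := Finset.HasAntidiagonal.mem_antidiagonal.1 hp
            omega
          rw [coeff_coeffDeriv, ih p.2 (by omega), map_zero, mul_zero]
  exact PowerSeries.ext fun m => by simpa using key m

lemma transport_inversionSeries_one :
    transport H (inversionSeries H 1) =
      inversionSeries H 1 * ∑ j, coeffDeriv j (inversionHom H (H j)) := by
  rw [transport_apply, derivative_inversionSeries, Finset.mul_sum, ← Finset.sum_sub_distrib]
  refine Finset.sum_congr rfl fun j _ => ?_
  rw [mul_one, inversionSeries_eq H (H j), Derivation.leibniz, smul_eq_mul, smul_eq_mul]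
  ring

lemma transport_inversionHom (u : MvPolynomial σ K) : transport H (inversionHom H u) = 0 := by
  have h : transport H (inversionSeries H u) =
      inversionHom H u * transport H (inversionSeries H 1) := by
    rw [transport_inversionSeries_one, transport_apply, derivative_inversionSeries,
      ← Finset.sum_sub_distrib, Finset.mul_sum, Finset.mul_sum]
    refine Finset.sum_congr rfl fun j _ => ?_
    rw [inversionSeries_eq H (H j * u), inversionSeries_eq H u, map_mul (inversionHom H)]
    simp only [Derivation.leibniz, smul_eq_mul]
    ring
  rw [inversionSeries_eq, Derivation.leibniz, smul_eq_mul, smul_eq_mul, add_eq_right] at h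
  exact (isUnit_inversionSeries_one H).mul_right_eq_zero.1 h

lemma transport_X : transport H PowerSeries.X = 1 := by
  simp [transport_apply, coeffDeriv_X]

/-- The Jacobian matrix `(∂H_i / ∂z_j)`. -/
def jacobianMatrix {R ι : Type*} [CommRing R] (H : ι → MvPolynomial ι R) :
    Matrix ι ι (MvPolynomial ι R) :=
  Matrix.of fun i j => pderiv j (H i)

/-- The matrix `1 - t (JH)(G)`, the Jacobian matrix of `z - t H` evaluated at `G`. -/
def transportedJacobian : Matrix σ σ (PowerSeries (MvPolynomial σ K)) :=
  1 - (PowerSeries.X : PowerSeries (MvPolynomial σ K)) • (jacobianMatrix H).map (inversionHom H)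

lemma transportedJacobian_mul :
    transportedJacobian H * Matrix.of (fun i j => coeffDeriv j (inversionHom H (X i))) = 1 := by
  rw [transportedJacobian, sub_mul, one_mul, sub_eq_iff_eq_add]
  ext1 i j
  simp only [Matrix.of_apply, Matrix.add_apply, smul_mul_assoc, Matrix.smul_apply, Matrix.mul_apply,
    Matrix.map_apply, jacobianMatrix, smul_eq_mul]
  rw [← coeffDeriv_algHom, inversionHom_X, map_add, coeffDeriv_C, Derivation.leibniz, coeffDeriv_X,
    smul_zero, add_zero, smul_eq_mul, pderiv_X, Matrix.one_apply]
  simp [Pi.single_apply, apply_ite]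

/-- The Jacobian factor of the inversion formula: both factors start with `1` and the product is
constant along the flow, because the divergence of the velocity `H(G)` is the trace appearing in
Jacobi's formula. -/
theorem inversionSeries_one_mul_det :
    inversionSeries H 1 * (transportedJacobian H).det = 1 := by
  set A := transportedJacobian H with hA
  set M : Matrix σ σ (PowerSeries (MvPolynomial σ K)) :=
    Matrix.of (fun i j => coeffDeriv j (inversionHom H (X i))) with hM
  have hAM : A * M = 1 := transportedJacobian_mul H
  -- `M` is the Jacobian matrix of `G`, the inverse of `A` by the chain rule.
  have hadj : A.adjugate = A.det • M := by
    rw [← mul_one A.adjugate, ← hAM, ← mul_assoc, Matrix.adjugate_mul, smul_mul_assoc, one_mul]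
  have hDA : A.map (transport H) = -(jacobianMatrix H).map (inversionHom H) := by
    ext1 i j
    simp [hA, transportedJacobian, Matrix.one_apply, apply_ite, transport_inversionHom, transport_X]
  have hdiv : ∑ j, coeffDeriv j (inversionHom H (H j)) =
      (M * (jacobianMatrix H).map (inversionHom H)).trace := by
    rw [Matrix.trace_mul_comm]
    simp only [Matrix.trace, Matrix.diag_apply, Matrix.mul_apply]
    exact Finset.sum_congr rfl fun j _ => coeffDeriv_algHom j _ _
  have hD : transport H (inversionSeries H 1 * A.det - 1) = 0 := by
    rw [map_sub, Derivation.map_one_eq_zero, sub_zero, Derivation.leibniz, derivation_map_det,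
      transport_inversionSeries_one, hadj, hDA, hdiv]
    simp only [mul_neg, smul_mul_assoc, Matrix.trace_neg, Matrix.trace_smul, smul_eq_mul]
    ring
  have hconst : PowerSeries.constantCoeff A.det = 1 := by
    rw [RingHom.map_det, ← Matrix.det_one (n := σ)]
    congr 1
    ext1 i j
    simp [hA, transportedJacobian, Matrix.one_apply, apply_ite]
  refine sub_eq_zero.1 (eq_zero_of_transport_eq_zero H hD ?_)
  simp [hconst]

/-- The Jacobian matrix of `H` is nilpotent, expressed as `det (1 - t JH) = 1` in `K[z][t]`. -/
def HasNilpotentJacobian {R ι : Type*} [CommRing R] [Fintype ι] [DecidableEq ι]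
    (H : ι → MvPolynomial ι R) : Prop :=
  (1 - (Polynomial.X : Polynomial (MvPolynomial ι R)) •
    (jacobianMatrix H).map Polynomial.C).det = 1

/-- The hypothesis `E_m(1) = 0` for `m ≥ 1` says that the Jacobian matrix of `H` is nilpotent, in the
form that its reversed characteristic polynomial is `1`. -/
theorem inversionCoeff_one_eq_zero_iff :
    (∀ m, 1 ≤ m → inversionCoeff H m 1 = 0) ↔ HasNilpotentJacobian H := by
  rw [HasNilpotentJacobian]
  set p := (1 - (Polynomial.X : Polynomial (MvPolynomial σ K)) •
        (jacobianMatrix H).map Polynomial.C).det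
  let Φ : Polynomial (MvPolynomial σ K) →+* PowerSeries (MvPolynomial σ K) :=
    Polynomial.eval₂RingHom (inversionHom H : MvPolynomial σ K →+* _) PowerSeries.X
  have hΦX : Φ Polynomial.X = PowerSeries.X := by simp [Φ]
  have hΦC (u : MvPolynomial σ K) : Φ (Polynomial.C u) = inversionHom H u := by simp [Φ]
  -- `Φ` preserves constant coefficients, so a polynomial in its kernel is divisible by `X`; the
  -- quotient is again in the kernel and has smaller degree.
  have hinj : Function.Injective Φ := by
    have hX : ∀ m (q : Polynomial (MvPolynomial σ K)), q.natDegree < m → Φ q = 0 → q = 0 := by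
      intro m
      induction m with
      | zero => intro q hq; omega
      | succ m ih =>
        intro q hq h
        have h0 : q.coeff 0 = 0 := by
          have h' := congrArg PowerSeries.constantCoeff h
          rw [← Polynomial.divX_mul_X_add q, map_add, map_mul, hΦX, hΦC] at h'
          simpa [constantCoeff_inversionHom] using h'
        have hq' := Polynomial.divX_mul_X_add q
        rw [h0, map_zero, add_zero] at hq'
        rw [← hq', map_mul, hΦX, mul_eq_zero, or_iff_left PowerSeries.X_ne_zero] at h
        by_cases hd : q.natDegree = 0
        · rw [Polynomial.eq_C_of_natDegree_eq_zero hd, h0, map_zero]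
        · rw [← hq', ih q.divX (by rw [Polynomial.natDegree_divX_eq_natDegree_tsub_one]; omega) h,
            zero_mul]
    exact (injective_iff_map_eq_zero Φ).2 fun q hq => hX _ q (Nat.lt_succ_self _) hq
  have hΦp : Φ p = (transportedJacobian H).det := by
    rw [RingHom.map_det]
    congr 1
    ext1 i j
    simp [transportedJacobian, Matrix.one_apply, apply_ite, hΦX, hΦC]
    exact mul_comm _ _
  have hone : inversionSeries H 1 = 1 ↔ p = 1 := by
    have h := inversionSeries_one_mul_det H
    rw [← hΦp] at h
    constructor
    · intro h1
      rw [h1, one_mul] at h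
      exact hinj (h.trans (map_one Φ).symm)
    · intro h1
      rwa [h1, map_one Φ, mul_one] at h
  rw [← hone, PowerSeries.ext_iff]
  refine ⟨fun h m => ?_, fun h m hm => ?_⟩
  · rw [coeff_inversionSeries, PowerSeries.coeff_one]
    split_ifs with hm
    · simp [hm]
    · exact h m (Nat.one_le_iff_ne_zero.2 hm)
  · have := h m
    rwa [coeff_inversionSeries, PowerSeries.coeff_one, if_neg (by omega)] at this

lemma inversionSeries_eq_inversionHom (h : ∀ m, 1 ≤ m → inversionCoeff H m 1 = 0)
    (u : MvPolynomial σ K) : inversionSeries H u = inversionHom H u := by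
  have h1 : inversionSeries H 1 = 1 := by
    ext1 m
    rw [coeff_inversionSeries, PowerSeries.coeff_one]
    split_ifs with hm
    · simp [hm]
    · exact h m (Nat.one_le_iff_ne_zero.2 hm)
  rw [inversionSeries_eq, h1, one_mul]

end Transport

/-! ### Nilpotent Jacobian matrices and the suspension of a map -/

section Suspension

lemma HasNilpotentJacobian.det_eval₂ {R ι A : Type*} [CommRing R] [Fintype ι] [DecidableEq ι]
    [CommRing A] {H : ι → MvPolynomial ι R} (hH : HasNilpotentJacobian H)
    (f : MvPolynomial ι R →+* A) (s : A) :
    (1 - s • (jacobianMatrix H).map f).det = 1 := by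
  have h := congrArg (Polynomial.eval₂RingHom f s) hH
  rw [RingHom.map_det, map_one] at h
  rw [← h]
  congr 1
  ext1 i j
  simp [Matrix.one_apply, apply_ite]
  exact mul_comm _ _

variable {K : Type*} [Field K] {n : ℕ}

/-- The map `(0, t H)` in the variables `(t, z)`, where `t` is the variable with index `0`. -/
def suspension (H : Fin n → MvPolynomial (Fin n) K) :
    Fin (n + 1) → MvPolynomial (Fin (n + 1)) K :=
  Fin.cons 0 fun i => X 0 * rename Fin.succ (H i)

lemma det_one_sub_suspension {A : Type*} [CommRing A] {H : Fin n → MvPolynomial (Fin n) K}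
    (hH : HasNilpotentJacobian H) (f : MvPolynomial (Fin (n + 1)) K →+* A) (s : A) :
    (1 - s • (jacobianMatrix (suspension H)).map f).det = 1 := by
  rw [Matrix.det_succ_row_zero, Finset.sum_eq_single 0 ?_ (by simp)]
  · have h := hH.det_eval₂ (f.comp (rename Fin.succ : _ →ₐ[K] _).toRingHom) (s * f (X 0))
    have h0 : (1 - s • (jacobianMatrix (suspension H)).map f) 0 0 = 1 := by
      simp [jacobianMatrix, suspension]
    rw [h0, Fin.val_zero, pow_zero, one_mul, one_mul, ← h]
    congr 1
    ext1 i j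
    have hs : j.succ ≠ 0 := Fin.succ_ne_zero j
    simp [jacobianMatrix, suspension, Matrix.one_apply, pderiv_X_of_ne hs.symm,
      pderiv_rename (Fin.succ_injective n), mul_assoc]
  · intro j _ hj
    simp [jacobianMatrix, suspension, hj.symm]

lemma HasNilpotentJacobian.suspension {H : Fin n → MvPolynomial (Fin n) K}
    (hH : HasNilpotentJacobian H) : HasNilpotentJacobian (suspension H) :=
  det_one_sub_suspension hH _ _

lemma jacobianDet_X_sub (H : Fin n → MvPolynomial (Fin n) K) :
    jacobianDet (fun i => X i - H i) = (1 - jacobianMatrix H).det := by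
  rw [jacobianDet]
  congr 1
  ext1 i j
  simp [jacobianMatrix, Matrix.one_apply, pderiv_X, Pi.single_apply]

end Suspension

/-! ### Formal and polynomial inverses -/

section Inverse

variable {K : Type*} [Field K]

/-- The inclusion of `K[z][t]` into `K[z]⟦t⟧`. -/
def polyToSeries (K σ : Type*) [Field K] :
    Polynomial (MvPolynomial σ K) →ₐ[K] PowerSeries (MvPolynomial σ K) :=
  (Polynomial.coeToPowerSeries.algHom (MvPolynomial σ K)).restrictScalars K

lemma polyToSeries_apply {σ : Type*} (p : Polynomial (MvPolynomial σ K)) :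
    polyToSeries K σ p = (p : PowerSeries (MvPolynomial σ K)) := by
  simp [polyToSeries]

lemma map_bind₁_eq_aeval {σ τ A : Type*} [CommRing A] [Algebra K A]
    (θ : MvPolynomial τ K →ₐ[K] A) (g : σ → MvPolynomial τ K) (p : MvPolynomial σ K) :
    θ (bind₁ g p) = aeval (fun i => θ (g i)) p :=
  AlgHom.congr_fun (comp_aeval g θ) p

variable [CharZero K]

/-- A polynomial inverse of `z - t H` is the formal inverse, so that the coefficients of the latter
vanish in high degree. -/
lemma vanishingFor_of_jacobianConjecture {n : ℕ} (hJC : JacobianConjecture K (n + 1))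
    (H : Fin n → MvPolynomial (Fin n) K) : VanishingFor (Lam K n) (xiPairing H) := by
  rw [vanishingFor_iff]
  intro hE
  have hnil : HasNilpotentJacobian H := (inversionCoeff_one_eq_zero_iff H).1 hE
  have hdet : jacobianDet (fun i => X i - suspension H i) = 1 := by
    rw [jacobianDet_X_sub]
    simpa using det_one_sub_suspension hnil (RingHom.id _) 1
  obtain ⟨G, hG, -⟩ := hJC _ hdet
  have hG0 : G 0 = X 0 := by simpa [comp, suspension] using congrFun hG 0
  have hGs (i : Fin n) : G i.succ = X i.succ + X 0 * bind₁ (fun k => G k.succ) (H i) := by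
    have h := congrFun hG i.succ
    simp only [comp, suspension, Fin.cons_succ, map_sub, map_mul, bind₁_X_right, hG0,
      bind₁_rename, Function.comp_def] at h
    rw [← h]
    ring
  let Θ : MvPolynomial (Fin (n + 1)) K →ₐ[K] PowerSeries (MvPolynomial (Fin n) K) :=
    (polyToSeries K (Fin n)).comp (finSuccEquiv K n).toAlgHom
  have hψ : aeval (fun k => Θ (G k.succ)) = inversionHom H := by
    apply eq_inversionHom
    intro k
    rw [aeval_X, ← map_bind₁_eq_aeval, hGs, map_add, map_mul]
    have h0 : Θ (X 0) = PowerSeries.X := by simp [Θ, polyToSeries_apply, finSuccEquiv_X_zero]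
    have hs : Θ (X k.succ) = PowerSeries.C (X k) := by
      simp [Θ, polyToSeries_apply, finSuccEquiv_X_succ]
    rw [h0, hs]
  refine ⟨Finset.univ.sup fun i => (finSuccEquiv K n (G (Fin.succ i))).natDegree,
    fun m hm i => ?_⟩
  have hdeg : (finSuccEquiv K n (G i.succ)).natDegree ≤ m :=
    (Finset.le_sup (f := fun i => (finSuccEquiv K n (G (Fin.succ i))).natDegree)
      (Finset.mem_univ i)).trans hm
  have h := congrArg (PowerSeries.coeff (m + 1)) (inversionHom_X H i)
  rw [← hψ, aeval_X] at h
  rw [hψ, ← inversionSeries_eq_inversionHom H hE, map_add, PowerSeries.coeff_succ_X_mul,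
    coeff_inversionSeries, PowerSeries.coeff_C, if_neg m.succ_ne_zero, zero_add] at h
  rw [← h]
  simpa [Θ, polyToSeries_apply] using
    Polynomial.coeff_eq_zero_of_natDegree_lt (Nat.lt_succ_of_le hdeg)

/-- If the formal inverse of `z - t H` has polynomial coefficients in `t`, then `t = 1` gives a right
inverse of `z - H`. -/
lemma exists_rightInverse_of_inversionCoeff {σ : Type*} [Fintype σ] [DecidableEq σ]
    (H : σ → MvPolynomial σ K) (hE : ∀ m, 1 ≤ m → inversionCoeff H m 1 = 0) {N : ℕ}
    (hN : ∀ m, N ≤ m → ∀ i, inversionCoeff H m (H i) = 0) :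
    ∃ g : σ → MvPolynomial σ K, ∀ i, g i = X i + bind₁ g (H i) := by
  let q (i : σ) : Polynomial (MvPolynomial σ K) := PowerSeries.trunc N (inversionHom H (H i))
  have hq (i : σ) : polyToSeries K σ (q i) = inversionHom H (H i) := by
    rw [polyToSeries_apply]
    ext1 m
    rw [Polynomial.coeff_coe, PowerSeries.coeff_trunc]
    split_ifs with hm
    · rfl
    · rw [← inversionSeries_eq_inversionHom H hE, coeff_inversionSeries, hN m (not_lt.1 hm)]
  let p (i : σ) : Polynomial (MvPolynomial σ K) := Polynomial.C (X i) + Polynomial.X * q i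
  have hp (i : σ) : polyToSeries K σ (p i) = inversionHom H (X i) := by
    rw [inversionHom_X, map_add, map_mul, hq]
    simp [polyToSeries_apply]
  have hφ : (polyToSeries K σ).comp (aeval p) = inversionHom H := by
    ext1 i
    simp [hp]
  have hpq (i : σ) : q i = aeval p (H i) := by
    have h := (hq i).trans (AlgHom.congr_fun hφ (H i)).symm
    rw [AlgHom.comp_apply, polyToSeries_apply, polyToSeries_apply] at h
    exact Polynomial.coe_injective _ h
  let ε : Polynomial (MvPolynomial σ K) →ₐ[K] MvPolynomial σ K :=
    (Polynomial.aeval (1 : MvPolynomial σ K)).restrictScalars K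
  refine ⟨fun i => ε (p i), fun i => ?_⟩
  have h := AlgHom.congr_fun (comp_aeval p ε) (H i)
  rw [AlgHom.comp_apply, ← hpq] at h
  change ε (Polynomial.C (X i) + Polynomial.X * q i) = X i + aeval _ (H i)
  rw [← h]
  simp [ε]

/-- The vanishing conjecture for `t B` provides a right inverse of `z - t B`, hence of `z - B`; the
factor `t` ensures order at least `2`. -/
lemma exists_rightInverse_fin {n : ℕ}
    (hVC : ∀ H : Fin (n + 1) → MvPolynomial (Fin (n + 1)) K, 2 ≤ tupleOrder H →
      VanishingFor (Lam K (n + 1)) (xiPairing H))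
    {B : Fin n → MvPolynomial (Fin n) K} (hB : ∀ i, constantCoeff (B i) = 0)
    (hnil : HasNilpotentJacobian B) :
    ∃ g : Fin n → MvPolynomial (Fin n) K, ∀ i, g i = X i + bind₁ g (B i) := by
  have hord : 2 ≤ tupleOrder (suspension B) := by
    refine le_iInf fun i => ?_
    refine Fin.cases ?_ (fun i => ?_) i
    · simp [suspension]
    · rw [suspension, Fin.cons_succ, MvPolynomial.coe_mul]
      refine le_trans ?_ MvPowerSeries.le_order_mul
      rw [← one_add_one_eq_two]
      refine add_le_add ?_ ?_ <;>
      rw [MvPowerSeries.one_le_order_iff_constCoeff_eq_zero,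
        ← MvPowerSeries.coeff_zero_eq_constantCoeff_apply, MvPolynomial.coeff_coe,
        ← MvPolynomial.constantCoeff_eq]
      · simp
      · rw [constantCoeff_rename, hB]
  have hE := (inversionCoeff_one_eq_zero_iff (suspension B)).2 hnil.suspension
  obtain ⟨N, hN⟩ := (vanishingFor_iff _).1 (hVC _ hord) hE
  obtain ⟨g, hg⟩ := exists_rightInverse_of_inversionCoeff _ hE hN
  have hg0 : g 0 = X 0 := by simpa [suspension] using hg 0
  let ε : MvPolynomial (Fin (n + 1)) K →ₐ[K] MvPolynomial (Fin n) K := aeval (Fin.cons 1 X)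
  have hε0 : ε (X 0) = 1 := by simp [ε]
  have hεs (i : Fin n) : ε (X i.succ) = X i := by simp [ε]
  refine ⟨fun i => ε (g i.succ), fun i => ?_⟩
  have h := hg i.succ
  rw [suspension, Fin.cons_succ, map_mul, bind₁_X_right, hg0, bind₁_rename] at h
  change ε (g i.succ) = X i + aeval _ (B i)
  rw [h, map_add, map_mul, hε0, hεs, one_mul, map_bind₁_eq_aeval]
  rfl

/-- The same for an arbitrary finite index type of variables, by renaming. -/
lemma exists_rightInverse
    (hVC : ∀ n : ℕ, 1 ≤ n → ∀ H : Fin n → MvPolynomial (Fin n) K, 2 ≤ tupleOrder H →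
      VanishingFor (Lam K n) (xiPairing H))
    {σ : Type*} [Fintype σ] [DecidableEq σ] {B : σ → MvPolynomial σ K}
    (hB : ∀ i, constantCoeff (B i) = 0) (hnil : HasNilpotentJacobian B) :
    ∃ g : σ → MvPolynomial σ K, ∀ i, g i = X i + bind₁ g (B i) := by
  let e := Fintype.equivFin σ
  let B' (i : Fin (Fintype.card σ)) : MvPolynomial (Fin (Fintype.card σ)) K :=
    rename e (B (e.symm i))
  have hnil' : HasNilpotentJacobian B' := by
    have h := hnil.det_eval₂ ((Polynomial.C).comp (rename e : _ →ₐ[K] _).toRingHom) Polynomial.X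
    rw [← Matrix.det_reindex_self e] at h
    refine Eq.trans (congrArg Matrix.det ?_) h
    ext1 i j
    have hj : pderiv j (B' i) = rename e (pderiv (e.symm j) (B (e.symm i))) := by
      rw [← pderiv_rename e.injective, e.apply_symm_apply]
    simp [jacobianMatrix, Matrix.one_apply, hj]
  obtain ⟨g, hg⟩ := exists_rightInverse_fin (B := B') (hVC _ (Nat.le_add_left 1 _))
    (fun i => by rw [constantCoeff_rename, hB]) hnil'
  refine ⟨fun i => rename e.symm (g (e i)), fun i => ?_⟩
  change rename e.symm (g (e i)) = X i + aeval _ (B i)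
  rw [hg, map_add, rename_X, e.symm_apply_apply, map_bind₁_eq_aeval, aeval_rename,
    e.symm_apply_apply]
  rfl

end Inverse

/-! ### Unfolding a sum of maps into a single map with nilpotent Jacobian -/

section Unfolding

open scoped Kronecker

variable {R : Type*} [CommRing R] {ι : Type*} {d : ℕ}

/-- The map `(y_0, …, y_d) ↦ (B_0(y_0) + y_1, …, B_{d-1}(y_0) + y_d, B_d(y_0))`. In
`y - B(y) = w` the blocks `y_1, …, y_d` can be eliminated, which leaves
`y_0 - ∑ k, B_k(y_0) = ∑ k, w_k`. -/
def unfolding (B : Fin (d + 1) → ι → MvPolynomial ι R) :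
    Fin (d + 1) × ι → MvPolynomial (Fin (d + 1) × ι) R :=
  fun p => rename (Prod.mk 0) (B p.1 p.2) +
    ∑ l : Fin (d + 1), if (l : ℕ) = p.1 + 1 then X (l, p.2) else 0

/-- The matrix `∑ m, s^m S^m`, where `S` is the shift matrix with ones above the diagonal. -/
def geomShift {A : Type*} [CommRing A] (d : ℕ) (s : A) : Matrix (Fin (d + 1)) (Fin (d + 1)) A :=
  Matrix.of fun k l => if k ≤ l then s ^ ((l : ℕ) - k) else 0

lemma det_geomShift {A : Type*} [CommRing A] (s : A) : (geomShift d s).det = 1 := by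
  rw [Matrix.det_of_isUpperTriangular]
  · simp [geomShift]
  · intro k l hkl
    have : ¬ k ≤ l := not_le.2 hkl
    simp [geomShift, this]

lemma geomShift_mul {A : Type*} [CommRing A] (s : A) :
    geomShift d s * (1 - s • Matrix.of fun k l : Fin (d + 1) => if (l : ℕ) = k + 1 then 1 else 0) =
      1 := by
  rw [mul_sub, mul_one, sub_eq_iff_eq_add]
  ext1 k l
  simp only [Matrix.add_apply, Matrix.mul_smul, Matrix.smul_apply, Matrix.mul_apply,
    Matrix.of_apply, smul_eq_mul, mul_ite, mul_one, mul_zero]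
  refine Fin.cases ?_ (fun l => ?_) l
  · rw [Finset.sum_eq_zero (fun m _ => by simp)]
    by_cases hk : k = 0
    · subst hk
      simp [geomShift]
    · simp [geomShift, hk]
  · rw [Finset.sum_eq_single l.castSucc]
    · rcases lt_trichotomy k l.succ with h | h | h
      · have h1 : k ≤ l.castSucc := Fin.le_castSucc_iff.2 h
        have h2 : (k : ℕ) ≤ l := h1
        rw [Matrix.one_apply_ne h.ne]
        simp only [geomShift, Matrix.of_apply, h.le, h1, if_true, Fin.val_succ, Fin.val_castSucc]
        rw [zero_add, ← pow_succ', Nat.sub_add_comm h2]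
      · subst h
        simp [geomShift]
      · have h1 : ¬ k ≤ l.castSucc := fun h' => h.not_gt (Fin.le_castSucc_iff.1 h')
        rw [Matrix.one_apply_ne h.ne']
        simp [geomShift, h1, h.not_ge]
    · intro m _ hm
      rw [if_neg]
      intro h
      exact hm (Fin.ext (by simpa using h.symm))
    · simp

/-- A right inverse of the unfolding, restricted to `w = (z, 0, …, 0)`, has as its first block a
right inverse of `z - ∑ k, B_k(z)`. -/
lemma exists_rightInverse_of_unfolding (B : Fin (d + 1) → ι → MvPolynomial ι R)
    {g : Fin (d + 1) × ι → MvPolynomial (Fin (d + 1) × ι) R}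
    (hg : ∀ p, g p = X p + bind₁ g (unfolding B p)) :
    ∃ f : ι → MvPolynomial ι R, ∀ i, f i = X i + bind₁ f (∑ k, B k i) := by
  let ε : MvPolynomial (Fin (d + 1) × ι) R →ₐ[R] MvPolynomial ι R :=
    aeval fun p => if p.1 = 0 then X p.2 else 0
  let y (k : Fin (d + 1)) (i : ι) : MvPolynomial ι R := ε (g (k, i))
  have hy (k : Fin (d + 1)) (i : ι) : y k i = (if k = 0 then X i else 0) + bind₁ (y 0) (B k i) +
      ∑ l : Fin (d + 1), if (l : ℕ) = k + 1 then y l i else 0 := by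
    have h := congrArg ε (hg (k, i))
    rw [unfolding, map_add, map_add, map_add, bind₁_rename, map_sum, map_sum] at h
    change y k i = _ at h
    rw [h, ← add_assoc]
    congr 1
    · congr 1
      · simp [ε]
      · exact AlgHom.congr_fun (comp_aeval (g ∘ Prod.mk 0) ε) (B k i)
    · refine Finset.sum_congr rfl fun l _ => ?_
      split_ifs <;> simp [y]
  refine ⟨y 0, fun i => ?_⟩
  have hsum : ∑ k, y k i = ∑ k : Fin (d + 1), ((if k = 0 then X i else 0) +
      bind₁ (y 0) (B k i) + ∑ l : Fin (d + 1), if (l : ℕ) = k + 1 then y l i else 0) :=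
    Finset.sum_congr rfl fun k _ => hy k i
  rw [Finset.sum_add_distrib, Finset.sum_add_distrib, Finset.sum_ite_eq',
    if_pos (Finset.mem_univ _), Finset.sum_comm (γ := Fin (d + 1))] at hsum
  -- Every block except `y_0` occurs exactly once as a successor, so the sums cancel.
  have htel : ∑ l : Fin (d + 1), ∑ k : Fin (d + 1), (if (l : ℕ) = k + 1 then y l i else 0) =
      ∑ l : Fin d, y l.succ i := by
    rw [Fin.sum_univ_succ, Finset.sum_eq_zero (fun k _ => by simp), zero_add]
    refine Finset.sum_congr rfl fun l _ => ?_
    rw [Finset.sum_eq_single l.castSucc]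
    · simp
    · intro k _ hk
      rw [if_neg]
      intro h
      exact hk (Fin.ext (by simpa using h.symm))
    · simp
  rw [htel, Fin.sum_univ_succ] at hsum
  rw [map_sum]
  exact add_right_cancel hsum

variable [Fintype ι] [DecidableEq ι]

/-- Eliminating all blocks but the first reduces the determinant of `1 - s JB` to that of
`1 - ∑ k, s^(k+1) JB_k`. -/
lemma hasNilpotentJacobian_unfolding (B : Fin (d + 1) → ι → MvPolynomial ι R)
    (hB : (1 - ∑ k : Fin (d + 1), (Polynomial.X : Polynomial (MvPolynomial ι R)) ^ ((k : ℕ) + 1) •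
      (jacobianMatrix (B k)).map Polynomial.C).det = 1) :
    HasNilpotentJacobian (unfolding B) := by
  let A := Polynomial (MvPolynomial (Fin (d + 1) × ι) R)
  let s : A := Polynomial.X
  let r : MvPolynomial ι R →+* A :=
    Polynomial.C.comp (rename (Prod.mk 0) : MvPolynomial ι R →ₐ[R] _).toRingHom
  let T : Matrix (Fin (d + 1)) (Fin (d + 1)) A :=
    1 - s • Matrix.of fun k l : Fin (d + 1) => if (l : ℕ) = k + 1 then 1 else 0
  let W : Matrix (Fin (d + 1) × ι) (Fin (d + 1) × ι) A := geomShift d s ⊗ₖ (1 : Matrix ι ι A)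
  let U : Matrix (Fin (d + 1) × ι) ι A := Matrix.of fun p j => s * r (pderiv j (B p.1 p.2))
  let V : Matrix ι (Fin (d + 1) × ι) A := Matrix.of fun j p => if p.1 = 0 ∧ p.2 = j then 1 else 0
  have hM : 1 - s • (jacobianMatrix (unfolding B)).map Polynomial.C =
      T ⊗ₖ (1 : Matrix ι ι A) - U * V := by
    ext1 ⟨k, i⟩ ⟨l, j⟩
    have hr : pderiv (l, j) (rename (Prod.mk (0 : Fin (d + 1))) (B k i)) =
        if l = 0 then rename (Prod.mk 0) (pderiv j (B k i)) else 0 := by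
      split_ifs with hl
      · rw [hl, pderiv_rename (Prod.mk_right_injective _)]
      · refine pderiv_eq_zero_of_notMem_vars fun h => hl ?_
        have := vars_rename _ _ h
        simp only [Finset.mem_image, Prod.mk.injEq] at this
        obtain ⟨_, _, h0, _⟩ := this
        exact h0.symm
    have hs : pderiv (l, j) (∑ m : Fin (d + 1), if (m : ℕ) = k + 1 then X (R := R) (m, i) else 0) =
        if (l : ℕ) = k + 1 ∧ i = j then 1 else 0 := by
      rw [map_sum, Finset.sum_eq_single l]
      · by_cases h1 : (l : ℕ) = k + 1 <;> by_cases h2 : i = j <;>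
          simp [h1, h2, pderiv_X, Prod.ext_iff]
      · intro m _ hm
        split_ifs
        · rw [pderiv_X_of_ne (by simp [hm])]
        · simp
      · simp
    have hUV : (U * V) (k, i) (l, j) = if l = 0 then s * r (pderiv j (B k i)) else 0 := by
      rw [Matrix.mul_apply, Finset.sum_eq_single j]
      · simp [U, V]
      · intro m _ hm
        simp [V, hm.symm]
      · simp
    rw [Matrix.sub_apply, Matrix.sub_apply, hUV, Matrix.smul_apply, Matrix.map_apply, jacobianMatrix,
      Matrix.of_apply, unfolding, map_add, hr, hs, Matrix.kroneckerMap_apply]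
    have hT : T k l = (if k = l then 1 else 0) - s * if (l : ℕ) = k + 1 then 1 else 0 := by
      simp only [T, Matrix.sub_apply, Matrix.smul_apply, Matrix.one_apply, Matrix.of_apply,
        smul_eq_mul]
    have hr' (u : MvPolynomial ι R) : r u = Polynomial.C (rename (Prod.mk 0) u) := rfl
    have hone : (1 : Matrix (Fin (d + 1) × ι) (Fin (d + 1) × ι) A) (k, i) (l, j) =
        (if k = l then 1 else 0) * if i = j then 1 else 0 := by
      rw [← Matrix.one_kronecker_one, Matrix.kroneckerMap_apply, Matrix.one_apply, Matrix.one_apply]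
    rw [hT, hone, Matrix.one_apply, hr', smul_eq_mul, map_add, ite_and, apply_ite Polynomial.C,
      apply_ite Polynomial.C, apply_ite Polynomial.C, map_one, map_zero, mul_add, mul_ite, mul_zero]
    split_ifs <;> ring
  have hW : W.det = 1 := by
    rw [Matrix.det_kronecker, det_geomShift, Matrix.det_one, one_pow, one_pow, one_mul]
  have hWT : W * T ⊗ₖ (1 : Matrix ι ι A) = 1 := by
    rw [← Matrix.mul_kronecker_mul, geomShift_mul, one_mul, Matrix.one_kronecker_one]
  have hVWU : V * (W * U) = (∑ k : Fin (d + 1), s ^ ((k : ℕ) + 1) •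
      (jacobianMatrix (B k)).map r) := by
    ext1 i j
    have hV : (V * (W * U)) i j = (W * U) (0, i) j := by
      rw [Matrix.mul_apply, Finset.sum_eq_single (0, i)]
      · simp [V]
      · rintro ⟨k, i'⟩ _ h
        have : ¬ (k = 0 ∧ i' = i) := fun h' => h (Prod.ext h'.1 h'.2)
        simp [V, this]
      · simp
    rw [hV, Matrix.mul_apply, Fintype.sum_prod_type, Matrix.sum_apply]
    refine Finset.sum_congr rfl fun k _ => ?_
    rw [Finset.sum_eq_single i]
    · simp [W, U, geomShift, jacobianMatrix, pow_succ, mul_assoc]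
    · intro i' _ h
      simp [W, h.symm]
    · simp
  have hB' : (1 - ∑ k : Fin (d + 1), s ^ ((k : ℕ) + 1) • (jacobianMatrix (B k)).map r).det = 1 := by
    have h := congrArg (Polynomial.eval₂RingHom r s) hB
    rw [RingHom.map_det, map_one] at h
    refine Eq.trans (congrArg Matrix.det ?_) h
    ext1 i j
    simp only [Matrix.sub_apply, Matrix.sum_apply, Matrix.smul_apply, Matrix.map_apply, smul_eq_mul,
      RingHom.mapMatrix_apply, map_sub, map_sum, Matrix.one_apply, Polynomial.coe_eval₂RingHom]
    congr 1
    · split_ifs <;> simp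
    · refine Finset.sum_congr rfl fun k _ => ?_
      rw [Polynomial.eval₂_mul, Polynomial.eval₂_pow, Polynomial.eval₂_X, Polynomial.eval₂_C]
  change (1 - s • (jacobianMatrix (unfolding B)).map Polynomial.C).det = 1
  rw [hM, ← one_mul (Matrix.det _), ← hW, ← Matrix.det_mul, mul_sub, hWT, ← Matrix.mul_assoc,
    Matrix.det_one_sub_mul_comm, hVWU, hB', hW]

end Unfolding

/-! ### Reduction of the Jacobian conjecture to nilpotent Jacobian matrices -/

section Reduction

/-- Grading by `s`: substituting `s z` for `z` multiplies the degree `m` part by `s^m`. -/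
lemma aeval_X_mul_C_of_isHomogeneous {R ι : Type*} [CommRing R] {p : MvPolynomial ι R} {m : ℕ}
    (hp : p.IsHomogeneous m) :
    aeval (fun i => (Polynomial.X : Polynomial (MvPolynomial ι R)) * Polynomial.C (X i)) p =
      Polynomial.X ^ m * Polynomial.C p := by
  conv_rhs => rw [p.as_sum]
  conv_lhs => rw [p.as_sum]
  rw [map_sum, map_sum, Finset.mul_sum]
  refine Finset.sum_congr rfl fun e he => ?_
  have hdeg : e.degree = m := by
    rw [Finsupp.degree_eq_weight_one]
    exact hp (mem_support_iff.1 he)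
  rw [aeval_monomial, monomial_eq, map_mul, ← hdeg, Finsupp.degree]
  simp only [Finsupp.prod, mul_pow, Finset.prod_mul_distrib, Finset.prod_pow_eq_pow_sum, map_prod,
    map_pow]
  have : algebraMap R (Polynomial (MvPolynomial ι R)) (coeff e p) = Polynomial.C (C (coeff e p)) :=
    rfl
  rw [this]
  exact mul_left_comm _ _ _

lemma homogeneousComponent_one_eq_zero {R ι : Type*} [CommRing R] {p : MvPolynomial ι R}
    (hp : ∀ j, constantCoeff (pderiv j p) = 0) : homogeneousComponent 1 p = 0 := by
  classical
  ext e
  rw [coeff_homogeneousComponent, coeff_zero]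
  split_ifs with he
  · obtain ⟨j, rfl⟩ : ∃ j, e = Finsupp.single j 1 := by
      have hj : ∃ j, e j ≠ 0 := by
        by_contra! h
        rw [show e = 0 from Finsupp.ext h] at he
        simp at he
      obtain ⟨j, hj⟩ := hj
      refine ⟨j, ?_⟩
      have hle : Finsupp.single j 1 ≤ e := by
        rw [Finsupp.single_le_iff]
        omega
      have hsub := tsub_add_cancel_of_le hle
      have h := congrArg Finsupp.degree hsub
      rw [map_add, he, Finsupp.degree_single] at h
      have h0 : e - Finsupp.single j 1 = 0 := (Finsupp.degree_eq_zero_iff _).1 (by omega)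
      rw [← hsub, h0, zero_add]
    have h := hp j
    rw [constantCoeff_eq, coeff_pderiv] at h
    simpa using h
  · rfl

lemma injective_of_surjective_ringHom {R : Type*} [CommRing R] [IsNoetherianRing R] (f : R →+* R)
    (hf : Function.Surjective f) : Function.Injective f := by
  have hmono : Monotone fun n : ℕ => RingHom.ker (f ^ n) := by
    refine monotone_nat_of_le_succ fun n x hx => ?_
    rw [RingHom.mem_ker] at hx ⊢
    rw [pow_succ', RingHom.mul_def, RingHom.comp_apply, hx, map_zero]
  obtain ⟨n, hn⟩ := monotone_stabilizes_iff_noetherian.2 ‹IsNoetherianRing R› ⟨_, hmono⟩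
  have hn' : RingHom.ker (f ^ n) = RingHom.ker (f ^ (n + 1)) := hn (n + 1) n.le_succ
  refine (injective_iff_map_eq_zero f).2 fun x hx => ?_
  obtain ⟨y, rfl⟩ : ∃ y, (f ^ n) y = x := by
    rw [RingHom.coe_pow]
    exact hf.iterate n x
  have hy : y ∈ RingHom.ker (f ^ (n + 1)) := by
    rw [RingHom.mem_ker, pow_succ', RingHom.mul_def, RingHom.comp_apply, hx]
  rw [← hn'] at hy
  exact hy

/-- A right inverse of a polynomial map is two-sided: its comorphism is a surjective endomorphism of
a Noetherian ring, hence injective. -/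
lemma isPolyAut_of_rightInverse {K : Type*} [Field K] {n : ℕ} {F G : Fin n → MvPolynomial (Fin n) K}
    (h : ∀ i, bind₁ G (F i) = X i) : IsPolyAut F := by
  refine ⟨G, funext h, funext fun i => ?_⟩
  have hid (p : MvPolynomial (Fin n) K) : bind₁ G (bind₁ F p) = p := by
    have : (bind₁ G).comp (bind₁ F) = AlgHom.id K (MvPolynomial (Fin n) K) := by
      ext1 i
      simp [h]
    exact AlgHom.congr_fun this p
  have hinj := injective_of_surjective_ringHom (bind₁ G).toRingHom fun p => ⟨_, hid p⟩
  exact hinj (by simpa [comp] using hid (G i))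

variable {K : Type*} [Field K] [CharZero K]

/-- A map `z - H` with `H` of order at least `2` and Jacobian determinant `1` has a right inverse,
by unfolding the decomposition of `H` into homogeneous parts. -/
lemma exists_rightInverse_of_order
    (hVC : ∀ n : ℕ, 1 ≤ n → ∀ H : Fin n → MvPolynomial (Fin n) K, 2 ≤ tupleOrder H →
      VanishingFor (Lam K n) (xiPairing H))
    {ι : Type*} [Fintype ι] [DecidableEq ι] {H : ι → MvPolynomial ι K}
    (h0 : ∀ i, constantCoeff (H i) = 0) (h1 : ∀ i j, constantCoeff (pderiv j (H i)) = 0)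
    (hdet : (1 - jacobianMatrix H).det = 1) :
    ∃ f : ι → MvPolynomial ι K, ∀ i, f i = X i + bind₁ f (H i) := by
  let d := Finset.univ.sup fun i => (H i).totalDegree
  let B (k : Fin (d + 1)) (i : ι) : MvPolynomial ι K := homogeneousComponent ((k : ℕ) + 2) (H i)
  have hsum (i : ι) : ∑ k, B k i = H i := by
    have hd : (H i).totalDegree ≤ d :=
      Finset.le_sup (f := fun i => (H i).totalDegree) (Finset.mem_univ i)
    have hz (m : ℕ) (hm : (H i).totalDegree < m) : homogeneousComponent m (H i) = 0 :=
      homogeneousComponent_eq_zero _ _ hm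
    have h2 : ∑ m ∈ Finset.range (d + 3), homogeneousComponent m (H i) = H i := by
      rw [← Finset.sum_subset (s₁ := Finset.range ((H i).totalDegree + 1))
        (Finset.range_subset_range.2 (by omega)), sum_homogeneousComponent]
      intro m _ hm
      exact hz m (by simpa using hm)
    rw [Finset.sum_range_succ', Finset.sum_range_succ', homogeneousComponent_zero,
      ← constantCoeff_eq, h0, map_zero, zero_add, homogeneousComponent_one_eq_zero (h1 i), add_zero,
      add_zero] at h2
    rw [← h2, ← Fin.sum_univ_eq_sum_range (fun k => homogeneousComponent (k + 1 + 1) (H i))]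
  have hB : (1 - ∑ k : Fin (d + 1), (Polynomial.X : Polynomial (MvPolynomial ι K)) ^ ((k : ℕ) + 1) •
      (jacobianMatrix (B k)).map Polynomial.C).det = 1 := by
    let η : MvPolynomial ι K →ₐ[K] Polynomial (MvPolynomial ι K) :=
      aeval fun i => (Polynomial.X : Polynomial (MvPolynomial ι K)) * Polynomial.C (X i)
    have h := congrArg η hdet
    rw [AlgHom.map_det, map_one] at h
    refine Eq.trans (congrArg Matrix.det ?_) h
    ext1 i j
    have hη : η (pderiv j (H i)) = ∑ k : Fin (d + 1),
        (Polynomial.X : Polynomial (MvPolynomial ι K)) ^ ((k : ℕ) + 1) *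
          Polynomial.C (pderiv j (B k i)) := by
      rw [← hsum i, map_sum, map_sum]
      exact Finset.sum_congr rfl fun k _ => aeval_X_mul_C_of_isHomogeneous
        (IsHomogeneous.pderiv (homogeneousComponent_isHomogeneous ((k : ℕ) + 2) (H i)))
    rw [AlgHom.mapMatrix_apply, Matrix.map_apply, Matrix.sub_apply, Matrix.sub_apply, map_sub,
      jacobianMatrix, Matrix.of_apply, hη, Matrix.sum_apply]
    congr 1
    rw [Matrix.one_apply, Matrix.one_apply]
    split_ifs <;> simp
  have hconst (p : Fin (d + 1) × ι) : constantCoeff (unfolding B p) = 0 := by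
    rw [unfolding, map_add, constantCoeff_rename, map_sum, constantCoeff_eq,
      coeff_homogeneousComponent, if_neg (by simp), zero_add]
    refine Finset.sum_eq_zero fun l _ => ?_
    split_ifs <;> simp
  obtain ⟨g, hg⟩ := exists_rightInverse hVC hconst (hasNilpotentJacobian_unfolding B hB)
  obtain ⟨f, hf⟩ := exists_rightInverse_of_unfolding B hg
  exact ⟨f, fun i => by rw [hf i, hsum]⟩

lemma jacobianConjecture_of_vanishing
    (hVC : ∀ n : ℕ, 1 ≤ n → ∀ H : Fin n → MvPolynomial (Fin n) K, 2 ≤ tupleOrder H →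
      VanishingFor (Lam K n) (xiPairing H)) (n : ℕ) : JacobianConjecture K n := by
  intro F hF
  let c (i : Fin n) : K := constantCoeff (F i)
  let L : Matrix (Fin n) (Fin n) K := (jacobianMatrix F).map constantCoeff
  have hL : L.det = 1 := by
    have h := congrArg (constantCoeff (σ := Fin n) (R := K)) hF
    rwa [jacobianDet, RingHom.map_det, map_one] at h
  let A := L.adjugate
  have hA : A.det = 1 := by simp [A, Matrix.det_adjugate, hL]
  have hAL : A * L = 1 := by rw [Matrix.adjugate_mul, hL, one_smul]
  have hLA : L * A = 1 := by rw [Matrix.mul_adjugate, hL, one_smul]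
  -- Normalise the affine part of `F` to the identity.
  let F' (i : Fin n) : MvPolynomial (Fin n) K := ∑ k, C (A i k) * (F k - C (c k))
  have hJ : jacobianMatrix F' = A.map C * jacobianMatrix F := by
    ext1 i j
    simp [jacobianMatrix, F', Matrix.mul_apply]
  have hJX : 1 - jacobianMatrix (fun i => X i - F' i) = jacobianMatrix F' := by
    ext1 i j
    simp [jacobianMatrix, Matrix.one_apply, pderiv_X, Pi.single_apply]
  obtain ⟨f, hf⟩ := exists_rightInverse_of_order hVC (H := fun i => X i - F' i)
    (fun i => by simp [F', c])
    (fun i j => by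
      have h := congrArg (fun M => constantCoeff (M i j)) hJ
      have hAL' := congrFun (congrFun hAL i) j
      simp only [jacobianMatrix, Matrix.mul_apply, Matrix.of_apply, Matrix.map_apply, map_sum,
        map_mul, constantCoeff_C] at h
      rw [Matrix.mul_apply] at hAL'
      rw [map_sub, map_sub, h]
      simp only [L, jacobianMatrix, Matrix.map_apply, Matrix.of_apply] at hAL'
      rw [hAL']
      rcases eq_or_ne i j with rfl | hij
      · simp
      · rw [pderiv_X_of_ne hij, Matrix.one_apply_ne hij, map_zero, sub_zero])
    (by
      have hFJ : (jacobianMatrix F).det = 1 := hF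
      have hAC : (A.map (C : K →+* MvPolynomial (Fin n) K)).det = 1 := by
        have h := RingHom.map_det (C : K →+* MvPolynomial (Fin n) K) A
        rw [hA, map_one] at h
        exact h.symm
      rw [hJX, hJ, Matrix.det_mul, hFJ, mul_one, hAC])
  have hF' (i : Fin n) : bind₁ f (F' i) = X i := by
    have h := hf i
    rw [map_sub, bind₁_X_right] at h
    linear_combination h
  have hFf (k : Fin n) : bind₁ f (F k) = C (c k) + ∑ i, C (L k i) * X i := by
    have h : ∑ i, C (L k i) * bind₁ f (F' i) = bind₁ f (F k) - C (c k) := by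
      simp only [F', map_sum, map_mul, map_sub, bind₁_C_right, Finset.mul_sum]
      rw [Finset.sum_comm]
      simp only [← mul_assoc, ← Finset.sum_mul, ← C_mul, ← map_sum, ← Matrix.mul_apply, hLA,
        Matrix.one_apply]
      simp
    simp only [hF'] at h
    rw [h]
    ring
  let a (i : Fin n) : MvPolynomial (Fin n) K := ∑ k, C (A i k) * (X k - C (c k))
  refine isPolyAut_of_rightInverse (G := fun i => bind₁ a (f i)) fun k => ?_
  rw [← bind₁_bind₁, hFf]
  simp only [map_add, map_sum, map_mul, bind₁_C_right, bind₁_X_right, a, Finset.mul_sum]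
  rw [Finset.sum_comm]
  simp only [← mul_assoc, ← Finset.sum_mul, ← C_mul, ← map_sum, ← Matrix.mul_apply, hLA,
    Matrix.one_apply]
  simp

end Reduction

end

end JacVan

theorem mainTheorem3 (K : Type*) [Field K] [CharZero K] :
    (∀ n : ℕ, 1 ≤ n → JacVan.JacobianConjecture K n) ↔
      (∀ n : ℕ, 1 ≤ n → ∀ H : Fin n → MvPolynomial (Fin n) K, 2 ≤ JacVan.tupleOrder H →
        JacVan.VanishingFor (JacVan.Lam K n) (JacVan.xiPairing H)) :=
  ⟨fun h n _ H _ => JacVan.vanishingFor_of_jacobianConjecture (h (n + 1) (Nat.le_add_left 1 n)) H,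
    fun h n _ => JacVan.jacobianConjecture_of_vanishing h n⟩
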